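/- For $a\in\mathbb{C}$ let $M_a$ be the Verma module of $\mathfrak{sl}_2=\langle e,f,h\rangle$ over $\mathbb{C}$ with highest weight $a$: it has basis $\{f^jv_a\mid j\ge 0\}$, and $e f^jv_a=j(a-j+1)f^{j-1}v_a$, $f f^jv_a=f^{j+1}v_a$, $h f^jv_a=(a-2j)f^jv_a$. Let $n,k\ge 0$ be integers, let $m=(m_1,\dots,m_n)\in\mathbb{Z}_{\ge 0}^n$, put $|m|=m_1+\cdots+m_n$, and let $M^{\otimes m}=M_{m_1}\otimes\cdots\otimes M_{m_n}$ with the usual action of $\mathfrak{sl}_2$ on a tensor product. For $\mu\in\mathbb{C}$ let $M^{\otimes m}[\mu]=\{x\in M^{\otimes m}\mid hx=\mu x\}$ be the weight subspace of weight $\mu$, and let \[ f:(M^{\otimes m}[|m|-2k+2])^*\to(M^{\otimes m}[|m|-2k])^* \] be the contragredient action of $f$ on the dual spaces, $(f\varphi)(x)=\varphi(ex)$. Equivalently, in the basis dual to the vectors $F_Jv=f^{j_1}v_{m_1}\otimes\cdots\otimes f^{j_n}v_{m_n}$, $f(F_Jv)^*=\sum_{i=1}^n(j_i+1)(m_i-j_i)(F_{J+1_i}v)^*$,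 where $J+1_i=(j_1,\dots,j_i+1,\dots,j_n)$. Theorem 5.1. If (1) $m_i\ge k$ for some $i$ with $1\le i\le n$, or (2) $|m|-k+1<0$, or (3) $|m|-k+1\ge k$, then $\ker f=0$ and $\dim\operatorname{coker} f=\binom{n+k-2}{k}$ (with the convention $\binom{a}{0}=1$ for every integer $a$). -/

import Mathlib

open scoped TensorProduct

namespace SlTwoVerma

/-- The underlying space of the Verma module `M_a` of `sl₂` with highest weight `a`: the complex
vector space with basis `v_a, f v_a, f² v_a, …`, indexed by the exponent of `f`. -/
def Verma (_a : ℂ) : Type := ℕ →₀ ℂ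

noncomputable instance (a : ℂ) : AddCommGroup (Verma a) :=
  inferInstanceAs (AddCommGroup (ℕ →₀ ℂ))

noncomputable instance (a : ℂ) : Module ℂ (Verma a) :=
  inferInstanceAs (Module ℂ (ℕ →₀ ℂ))

/-- The basis `k ↦ f^k v_a` of `M_a`. -/
noncomputable def vermaBasis (a : ℂ) : Module.Basis ℕ ℂ (Verma a) :=
  Module.Basis.ofRepr (LinearEquiv.refl ℂ (ℕ →₀ ℂ))

/-- The action of `e` on `M_a`: `f^k v_a ↦ k (a - k + 1) f^(k-1) v_a` (zero for `k = 0`). -/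
noncomputable def vermaE (a : ℂ) : Module.End ℂ (Verma a) :=
  (vermaBasis a).constr ℂ fun k => ((k : ℂ) * (a - k + 1)) • vermaBasis a (k - 1)

/-- The action of `f` on `M_a`: `f^k v_a ↦ f^(k+1) v_a`. -/
noncomputable def vermaF (a : ℂ) : Module.End ℂ (Verma a) :=
  (vermaBasis a).constr ℂ fun k => vermaBasis a (k + 1)

/-- The action of `h` on `M_a`: `f^k v_a ↦ (a - 2k) f^k v_a`. -/
noncomputable def vermaH (a : ℂ) : Module.End ℂ (Verma a) :=
  (vermaBasis a).constr ℂ fun k => (a - 2 * k) • vermaBasis a k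

theorem vermaE_basis (a : ℂ) (k : ℕ) :
    vermaE a (vermaBasis a k) = ((k : ℂ) * (a - k + 1)) • vermaBasis a (k - 1) :=
  (vermaBasis a).constr_basis ℂ _ k

theorem vermaF_basis (a : ℂ) (k : ℕ) : vermaF a (vermaBasis a k) = vermaBasis a (k + 1) :=
  (vermaBasis a).constr_basis ℂ _ k

theorem vermaH_basis (a : ℂ) (k : ℕ) :
    vermaH a (vermaBasis a k) = (a - 2 * k) • vermaBasis a k :=
  (vermaBasis a).constr_basis ℂ _ k

/-- The three relations of `sl₂` hold on `M_a`. -/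
theorem verma_relations (a : ℂ) :
    ⁅vermaE a, vermaF a⁆ = vermaH a ∧
      ⁅vermaH a, vermaE a⁆ = (2 : ℂ) • vermaE a ∧
      ⁅vermaH a, vermaF a⁆ = (-2 : ℂ) • vermaF a := by
  refine ⟨?_, ?_, ?_⟩ <;> refine (vermaBasis a).ext fun k => ?_ <;> rcases k with _ | k <;>
    simp only [Ring.lie_def, LinearMap.sub_apply, Module.End.mul_apply, LinearMap.smul_apply,
      vermaE_basis, vermaF_basis, vermaH_basis, map_smul, smul_smul, Nat.cast_add, Nat.cast_zero,
      Nat.cast_one, Nat.add_sub_cancel, zero_mul, zero_smul,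
      zero_add, Nat.zero_sub, Nat.sub_self, map_zero] <;>
    module

variable {n : ℕ}

/-- The tensor product `M_{m_1} ⊗ ⋯ ⊗ M_{m_n}` of Verma modules. -/
abbrev TensorVerma (m : Fin n → ℂ) : Type := ⨂[ℂ] i, Verma (m i)

/-- The action of a Lie algebra element on a tensor product of modules, given its actions `x i`
on the factors: `∑ i, 1 ⊗ ⋯ ⊗ x i ⊗ ⋯ ⊗ 1`, with `x i` in position `i`. -/
noncomputable def tensorAction (m : Fin n → ℂ) (x : (i : Fin n) → Module.End ℂ (Verma (m i))) :
    Module.End ℂ (TensorVerma m) :=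
  ∑ i, PiTensorProduct.map (Function.update (fun _ => LinearMap.id) i (x i))

/-- The action of `e` on `M_{m_1} ⊗ ⋯ ⊗ M_{m_n}`. -/
noncomputable def tensorE (m : Fin n → ℂ) : Module.End ℂ (TensorVerma m) :=
  tensorAction m fun i => vermaE (m i)

/-- The action of `h` on `M_{m_1} ⊗ ⋯ ⊗ M_{m_n}`. -/
noncomputable def tensorH (m : Fin n → ℂ) : Module.End ℂ (TensorVerma m) :=
  tensorAction m fun i => vermaH (m i)

theorem map_update_tprod (m : Fin n → ℂ) (i : Fin n) (x : Module.End ℂ (Verma (m i)))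
    (v : (i : Fin n) → Verma (m i)) :
    PiTensorProduct.map (Function.update (fun _ => LinearMap.id) i x)
        (PiTensorProduct.tprod ℂ v) =
      PiTensorProduct.tprod ℂ (Function.update v i (x (v i))) := by
  rw [PiTensorProduct.map_tprod]
  congr 1
  ext1 l
  rcases eq_or_ne l i with rfl | hl
  · simp
  · simp [Function.update_of_ne hl]

theorem tensorAction_lie (m : Fin n → ℂ) (x y : (i : Fin n) → Module.End ℂ (Verma (m i))) :
    ⁅tensorAction m x, tensorAction m y⁆ = tensorAction m fun i => ⁅x i, y i⁆ := by
  rw [Ring.lie_def]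
  simp only [tensorAction]
  rw [Finset.sum_mul_sum, Finset.sum_mul_sum, Finset.sum_comm, ← Finset.sum_sub_distrib]
  refine Finset.sum_congr rfl fun i _ => ?_
  rw [← Finset.sum_sub_distrib, Finset.sum_eq_single i]
  · refine PiTensorProduct.ext (MultilinearMap.ext fun v => ?_)
    simp only [LinearMap.compMultilinearMap_apply, LinearMap.sub_apply, Module.End.mul_apply,
      map_update_tprod, Function.update_self, Function.update_idem, Ring.lie_def]
    rw [MultilinearMap.map_update_sub]
  · intro j _ hj
    refine PiTensorProduct.ext (MultilinearMap.ext fun v => ?_)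
    simp only [LinearMap.compMultilinearMap_apply, LinearMap.sub_apply, Module.End.mul_apply,
      map_update_tprod, Function.update_of_ne hj, Function.update_of_ne hj.symm]
    rw [Function.update_comm hj, sub_self]
    rfl
  · simp

theorem tensorH_tensorE (m : Fin n → ℂ) :
    ⁅tensorH m, tensorE m⁆ = (2 : ℂ) • tensorE m := by
  rw [tensorH, tensorE, tensorAction_lie]
  simp only [(verma_relations _).2.1, tensorAction, PiTensorProduct.map_update_smul,
    Finset.smul_sum]

/-- The weight subspace of weight `μ` of `M_{m_1} ⊗ ⋯ ⊗ M_{m_n}`: all `x` with `h x = μ x`. -/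
noncomputable def weightSpace (m : Fin n → ℂ) (μ : ℂ) : Submodule ℂ (TensorVerma m) :=
  Module.End.eigenspace (tensorH m) μ

theorem tensorE_mem (m : Fin n → ℂ) (μ : ℂ) :
    ∀ x ∈ weightSpace m μ, tensorE m x ∈ weightSpace m (μ + 2) := by
  intro x hx
  rw [weightSpace, Module.End.mem_eigenspace_iff] at hx ⊢
  have h := LinearMap.congr_fun (tensorH_tensorE m) x
  simp only [Ring.lie_def, LinearMap.sub_apply, Module.End.mul_apply, hx, map_smul,
    LinearMap.smul_apply] at h
  rw [sub_eq_iff_eq_add.mp h, ← add_smul, add_comm]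

/-- The contragredient action of `f`, from the dual of the weight subspace of weight `μ + 2` to
the dual of the weight subspace of weight `μ`: `(f φ)(x) = φ (e x)`. -/
noncomputable def contraF (m : Fin n → ℂ) (μ : ℂ) :
    Module.Dual ℂ (weightSpace m (μ + 2)) →ₗ[ℂ] Module.Dual ℂ (weightSpace m μ) :=
  ((tensorE m).restrict (tensorE_mem m μ)).dualMap

/-- The basis vector `F_J v = f^{j_1} v_{m_1} ⊗ ⋯ ⊗ f^{j_n} v_{m_n}`. -/
noncomputable def monomial (m : Fin n → ℂ) (J : Fin n → ℕ) : TensorVerma m :=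
  ⨂ₜ[ℂ] i, vermaBasis (m i) (J i)

theorem tensorH_monomial (m : Fin n → ℂ) (J : Fin n → ℕ) :
    tensorH m (monomial m J) = ((∑ i, m i) - 2 * ∑ i, (J i : ℂ)) • monomial m J := by
  simp only [tensorH, tensorAction, LinearMap.sum_apply, monomial, map_update_tprod,
    vermaH_basis, MultilinearMap.map_update_smul, Function.update_eq_self]
  rw [← Finset.sum_smul, Finset.sum_sub_distrib, ← Finset.mul_sum]

theorem tensorE_monomial (m : Fin n → ℂ) (J : Fin n → ℕ) :
    tensorE m (monomial m J) =
      ∑ i, ((J i : ℂ) * (m i - J i + 1)) • monomial m (Function.update J i (J i - 1)) := by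
  simp only [tensorE, tensorAction, LinearMap.sum_apply, monomial, map_update_tprod,
    vermaE_basis, MultilinearMap.map_update_smul]
  refine Finset.sum_congr rfl fun i _ => ?_
  congr 2
  ext1 l
  rcases eq_or_ne l i with rfl | hl
  · simp
  · simp [Function.update_of_ne hl]

end SlTwoVerma

open Module SlTwoVerma

namespace SlTwoVerma

/-! The map in question is the transpose of `e` from degree `k` to degree `k - 1`, so it is
injective once `e` is onto. Its cokernel then has dimension `n.multichoose k - n.multichoose (k -
1)`, by counting monomials. Under (2) or (3), surjectivity is pure `sl₂` theory: commuting `e` past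
powers of `f` (`tensorE_tensorF_pow`) produces the scalars `|m| - k - d + 1`, `0 ≤ d < k`, which are
all nonzero. Under (1), it is a triangularity argument on the exponent in position `i`
(`tensorE_surjective_of_le`). -/

/-- A diagonal operator multiplies the `i`-th coordinate by `c i`, so an eigenvector for `μ` is
supported where `c i = μ`. -/
theorem eigenspace_eq_span_of_diagonal {ι K V : Type*} [Field K] [AddCommGroup V] [Module K V]
    (b : Basis ι K V) (T : End K V) (c : ι → K) (hT : ∀ i, T (b i) = c i • b i) (μ : K) :
    End.eigenspace T μ = Submodule.span K (b '' {i | c i = μ}) := by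
  refine le_antisymm (fun x hx => ?_) (Submodule.span_le.2 ?_)
  · rw [End.mem_eigenspace_iff] at hx
    rw [b.mem_span_image]
    intro i hi
    have key : ∀ y, b.repr (T y) i = c i * b.repr y i := fun y => by
      have : (b.coord i) ∘ₗ T = c i • b.coord i := by
        refine b.ext fun j => ?_
        rcases eq_or_ne i j with rfl | h
        · simp [hT]
        · simp [hT, h.symm]
      simpa using LinearMap.congr_fun this y
    have h := key x
    rw [hx, map_smul, Finsupp.smul_apply, smul_eq_mul] at h
    exact (mul_right_cancel₀ (by simpa using hi) h).symm
  · rintro _ ⟨i, rfl, rfl⟩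
    exact End.mem_eigenspace_iff.2 (hT i)

/-! ### Commutation relations on the tensor product -/

/-- The action of `f` on `M_{m_1} ⊗ ⋯ ⊗ M_{m_n}`. -/
noncomputable def tensorF {n : ℕ} (m : Fin n → ℂ) : End ℂ (TensorVerma m) :=
  tensorAction m fun i => vermaF (m i)

theorem tensorE_tensorF {n : ℕ} (m : Fin n → ℂ) : ⁅tensorE m, tensorF m⁆ = tensorH m := by
  rw [tensorE, tensorF, tensorAction_lie, tensorH]
  simp only [(verma_relations _).1]

theorem tensorH_tensorF {n : ℕ} (m : Fin n → ℂ) :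
    ⁅tensorH m, tensorF m⁆ = (-2 : ℂ) • tensorF m := by
  rw [tensorH, tensorF, tensorAction_lie]
  simp only [(verma_relations _).2.2, tensorAction, PiTensorProduct.map_update_smul,
    Finset.smul_sum]

theorem mem_weightSpace {n : ℕ} {m : Fin n → ℂ} {μ : ℂ} {x : TensorVerma m} :
    x ∈ weightSpace m μ ↔ tensorH m x = μ • x :=
  End.mem_eigenspace_iff

theorem tensorF_pow_mem {n : ℕ} {m : Fin n → ℂ} {μ : ℂ} (j : ℕ) {x : TensorVerma m}
    (hx : x ∈ weightSpace m μ) : (tensorF m ^ j) x ∈ weightSpace m (μ - 2 * j) := by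
  induction j with
  | zero => simpa using hx
  | succ j ih =>
    have h := LinearMap.congr_fun (tensorH_tensorF m) ((tensorF m ^ j) x)
    rw [mem_weightSpace] at ih ⊢
    simp only [Ring.lie_def, LinearMap.sub_apply, Module.End.mul_apply, ih, map_smul,
      LinearMap.smul_apply] at h
    rw [pow_succ', Module.End.mul_apply, sub_eq_iff_eq_add.mp h, ← add_smul]
    congr 1
    push_cast
    ring

/-- Each further `f` adds the weight of the vector it acts on, and `μ + (μ - 2) + ⋯ + (μ - 2j) = (j
+ 1)(μ - j)`. -/
theorem tensorE_tensorF_pow {n : ℕ} {m : Fin n → ℂ} {μ : ℂ} (j : ℕ) {x : TensorVerma m}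
    (hx : x ∈ weightSpace m μ) :
    tensorE m ((tensorF m ^ (j + 1)) x) = (tensorF m ^ (j + 1)) (tensorE m x) +
      ((j + 1 : ℂ) * (μ - j)) • (tensorF m ^ j) x := by
  induction j with
  | zero =>
    have h := LinearMap.congr_fun (tensorE_tensorF m) x
    rw [mem_weightSpace] at hx
    simp only [Ring.lie_def, LinearMap.sub_apply, Module.End.mul_apply, hx] at h
    simp [sub_eq_iff_eq_add'.mp h]
  | succ j ih =>
    have h := LinearMap.congr_fun (tensorE_tensorF m) ((tensorF m ^ (j + 1)) x)
    have hw := tensorF_pow_mem (j + 1) hx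
    rw [mem_weightSpace] at hw
    simp only [Ring.lie_def, LinearMap.sub_apply, Module.End.mul_apply, hw] at h
    rw [pow_succ', Module.End.mul_apply, sub_eq_iff_eq_add'.mp h, ih, map_add, map_smul,
      ← Module.End.mul_apply (tensorF m), ← Module.End.mul_apply (tensorF m), ← pow_succ',
      ← pow_succ', add_assoc, ← add_smul]
    congr 2
    push_cast
    ring

/-! ### Monomial bases and dimensions of weight subspaces -/

/-- The monomials `F_J v` form a basis of `M_{m_1} ⊗ ⋯ ⊗ M_{m_n}`. -/
noncomputable def monomialBasis {n : ℕ} (m : Fin n → ℂ) :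
    Basis (Fin n → ℕ) ℂ (TensorVerma m) :=
  Basis.piTensorProduct fun i => vermaBasis (m i)

theorem monomialBasis_apply {n : ℕ} (m : Fin n → ℂ) (J : Fin n → ℕ) :
    monomialBasis m J = monomial m J :=
  Basis.piTensorProduct_apply _ J

theorem weightSpace_eq_span {n : ℕ} (m : Fin n → ℂ) (μ : ℂ) :
    weightSpace m μ = Submodule.span ℂ
      (monomialBasis m '' {J | (∑ i, m i) - 2 * ∑ i, (J i : ℂ) = μ}) :=
  eigenspace_eq_span_of_diagonal _ _ _
    (fun J => by rw [monomialBasis_apply, tensorH_monomial]) μ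

theorem weightSpace_degree {n : ℕ} (m : Fin n → ℂ) (d : ℕ) :
    weightSpace m ((∑ i, m i) - 2 * d) =
      Submodule.span ℂ (monomialBasis m '' {J | ∑ i, J i = d}) := by
  rw [weightSpace_eq_span]
  congr 2
  ext J
  simp only [Set.mem_ofPred_eq, sub_right_inj, mul_right_inj' (two_ne_zero' ℂ)]
  exact_mod_cast Iff.rfl

theorem weightSpace_above_top {n : ℕ} (m : Fin n → ℂ) : weightSpace m ((∑ i, m i) + 2) = ⊥ := by
  rw [weightSpace_eq_span, Submodule.span_eq_bot]
  rintro _ ⟨J, hJ, -⟩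
  exfalso
  have h : ((∑ i, J i + 1 : ℕ) : ℂ) = 0 := by
    push_cast
    have hJ' : (∑ i, m i) - 2 * ∑ i, (J i : ℂ) = (∑ i, m i) + 2 := hJ
    linear_combination (-1 / 2 : ℂ) * hJ'
  exact Nat.succ_ne_zero _ (Nat.cast_eq_zero.1 h)

theorem natCard_degree (n d : ℕ) : Nat.card {J : Fin n → ℕ // ∑ i, J i = d} = n.multichoose d := by
  rw [← Nat.card_congr (Sym.equivNatSumOfFintype (Fin n) d), Nat.card_eq_fintype_card,
    Sym.card_sym_fin_eq_multichoose]

/-- The monomials of degree `d` form a basis of the weight subspace of weight `|m| - 2d`. -/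
noncomputable def weightBasis {n : ℕ} (m : Fin n → ℂ) (d : ℕ) :
    Basis {J : Fin n → ℕ // ∑ i, J i = d} ℂ (weightSpace m ((∑ i, m i) - 2 * d)) :=
  (Basis.span ((monomialBasis m).linearIndependent.comp
    (Subtype.val : {J : Fin n → ℕ // ∑ i, J i = d} → _) Subtype.val_injective)).map
    (LinearEquiv.ofEq _ _ (by
      rw [weightSpace_degree, Set.range_comp, Subtype.range_coe_subtype]))

theorem finite_degree (n d : ℕ) : Finite {J : Fin n → ℕ // ∑ i, J i = d} :=
  Finite.of_equiv _ (Sym.equivNatSumOfFintype (Fin n) d)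

theorem finite_weightSpace {n : ℕ} (m : Fin n → ℂ) (d : ℕ) :
    Module.Finite ℂ (weightSpace m ((∑ i, m i) - 2 * d)) :=
  have := finite_degree n d
  Module.Finite.of_basis (weightBasis m d)

theorem finrank_weightSpace {n : ℕ} (m : Fin n → ℂ) (d : ℕ) :
    finrank ℂ (weightSpace m ((∑ i, m i) - 2 * d)) = n.multichoose d := by
  rw [finrank_eq_nat_card_basis (weightBasis m d), natCard_degree]

/-! ### Surjectivity of `e` -/

/-- If `|m| - k - d + 1 ≠ 0` for `0 ≤ d < k`, then `e` is onto the weight subspace of weight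
`|m| - 2(k - 1)`. -/
theorem tensorE_surjective_of_ne {n : ℕ} (m : Fin n → ℂ) (k : ℕ)
    (h : ∀ d < k, (∑ i, m i) - k - d + 1 ≠ 0) :
    weightSpace m ((∑ i, m i) - 2 * k + 2) ≤
      (weightSpace m ((∑ i, m i) - 2 * k)).map (tensorE m) := by
  -- Solve the commutation formula for `f^j y`: besides a multiple of `e (f^(j+1) y)`, only `f^(j+1)
  -- (e y)` remains, and `e y` has degree `d - 1`. This drives an induction on `d`, whose case `j =
  -- 0` is the claim.
  have step : ∀ d j : ℕ, d + j + 1 = k → ∀ y ∈ weightSpace m ((∑ i, m i) - 2 * d),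
      (tensorF m ^ (j + 1)) (tensorE m y) ∈
        (weightSpace m ((∑ i, m i) - 2 * k)).map (tensorE m) →
      (tensorF m ^ j) y ∈ (weightSpace m ((∑ i, m i) - 2 * k)).map (tensorE m) := by
    intro d j hj y hy hE
    have hk : (k : ℂ) = d + j + 1 := by exact_mod_cast hj.symm
    have hF := tensorF_pow_mem (j + 1) hy
    rw [show (∑ i, m i) - 2 * (d : ℂ) - 2 * ((j + 1 : ℕ) : ℂ) = (∑ i, m i) - 2 * k by
      rw [hk]; push_cast; ring] at hF
    -- Since `j = k - 1 - d`, the second factor is `|m| - k - d + 1`.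
    have hc : ((j + 1 : ℂ) * ((∑ i, m i) - 2 * d - j)) ≠ 0 := by
      refine mul_ne_zero (Nat.cast_add_one_ne_zero j) ?_
      convert h d (by omega) using 1
      rw [hk]
      ring
    rw [← Submodule.smul_mem_iff _ hc, ← sub_eq_iff_eq_add'.2 (tensorE_tensorF_pow j hy)]
    exact Submodule.sub_mem _ (Submodule.mem_map_of_mem hF) hE
  have key : ∀ d j : ℕ, d + j + 1 = k → ∀ y ∈ weightSpace m ((∑ i, m i) - 2 * d),
      (tensorF m ^ j) y ∈ (weightSpace m ((∑ i, m i) - 2 * k)).map (tensorE m) := by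
    intro d
    induction d with
    | zero =>
      intro j hj y hy
      have hE : tensorE m y = 0 := by
        have := tensorE_mem m _ y hy
        rw [Nat.cast_zero, mul_zero, sub_zero, weightSpace_above_top] at this
        simpa using this
      refine step 0 j hj y hy ?_
      rw [hE, map_zero]
      exact Submodule.zero_mem _
    | succ d ih =>
      intro j hj y hy
      refine step (d + 1) j hj y hy (ih (j + 1) (by omega) _ ?_)
      convert tensorE_mem m _ y hy using 2
      push_cast
      ring
  rcases k with _ | k
  · rw [Nat.cast_zero, mul_zero, sub_zero, weightSpace_above_top]
    exact bot_le
  · intro y hy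
    refine key k 0 rfl y ?_
    convert hy using 2
    push_cast
    ring

theorem sum_update_add {n : ℕ} (J : Fin n → ℕ) (i : Fin n) (v : ℕ) :
    ∑ l, Function.update J i v l + J i = ∑ l, J l + v := by
  rw [Finset.sum_update_of_mem (Finset.mem_univ i), ← Finset.add_sum_erase _ J (Finset.mem_univ i),
    Finset.sdiff_singleton_eq_erase]
  ring

/-- If `m_i ≥ k` for some `i`, then `e` is onto the weight subspace of weight `|m| - 2(k - 1)`. -/
theorem tensorE_surjective_of_le {n : ℕ} (m : Fin n → ℕ) (k : ℕ) (i : Fin n) (hi : k ≤ m i) :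
    weightSpace (fun i => (m i : ℂ)) ((∑ i, (m i : ℂ)) - 2 * k + 2) ≤
      (weightSpace (fun i => (m i : ℂ)) ((∑ i, (m i : ℂ)) - 2 * k)).map
        (tensorE fun i => (m i : ℂ)) := by
  rcases k with _ | k
  · rw [Nat.cast_zero, mul_zero, sub_zero, weightSpace_above_top]
    exact bot_le
  rw [show (∑ i, (m i : ℂ)) - 2 * ((k + 1 : ℕ) : ℂ) + 2 = (∑ i, (m i : ℂ)) - 2 * k by
    push_cast; ring, weightSpace_degree, weightSpace_degree, Submodule.span_le]
  set R := (Submodule.span ℂ (monomialBasis (fun i => (m i : ℂ)) '' {J | ∑ i, J i = k + 1})).map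
    (tensorE fun i => (m i : ℂ))
  -- Apply `e` to `F_{J+1_i} v`: the `i`-th term is `(J i + 1)(m i - J i)` times `F_J v`, nonzero
  -- because `J i ≤ k < m i`. Every other nonzero term keeps the exponent `J i + 1` in position `i`.
  have step : ∀ J : Fin n → ℕ, ∑ l, J l = k →
      (∀ J' : Fin n → ℕ, ∑ l, J' l = k → J' i = J i + 1 → monomial (fun i => (m i : ℂ)) J' ∈ R) →
      monomial (fun i => (m i : ℂ)) J ∈ R := by
    intro J hJ ih
    have hle : J i ≤ k := hJ ▸ Finset.single_le_sum (fun _ _ => Nat.zero_le _) (Finset.mem_univ i)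
    set J' := Function.update J i (J i + 1) with hJ'
    have hJ'i : J' i = J i + 1 := Function.update_self ..
    have hsum : ∑ l, J' l = k + 1 := by
      have := sum_update_add J i (J i + 1)
      rw [← hJ'] at this
      omega
    have hE : tensorE (fun i => (m i : ℂ)) (monomial _ J') ∈ R :=
      Submodule.mem_map_of_mem (Submodule.subset_span ⟨J', hsum, monomialBasis_apply _ _⟩)
    rw [tensorE_monomial, ← Finset.add_sum_erase _ _ (Finset.mem_univ i)] at hE
    have hrest := (Submodule.add_mem_iff_left R (Submodule.sum_mem R fun l hl => ?_)).1 hE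
    · have hc : ((J' i : ℂ) * ((m i : ℂ) - J' i + 1)) ≠ 0 := by
        rw [hJ'i]
        refine mul_ne_zero (Nat.cast_ne_zero.2 (Nat.succ_ne_zero _)) ?_
        have : ((m i - J i : ℕ) : ℂ) ≠ 0 := Nat.cast_ne_zero.2 (by omega)
        rw [Nat.cast_sub (by omega)] at this
        convert this using 1
        push_cast
        ring
      rw [Submodule.smul_mem_iff _ hc] at hrest
      simpa [hJ'] using hrest
    · have hli : l ≠ i := Finset.ne_of_mem_erase hl
      have hJ'l : J' l = J l := Function.update_of_ne hli ..
      rcases Nat.eq_zero_or_pos (J l) with h0 | hpos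
      · rw [hJ'l, h0, Nat.cast_zero, zero_mul, zero_smul]
        exact Submodule.zero_mem _
      · refine Submodule.smul_mem _ _ (ih _ ?_ ?_)
        · have := sum_update_add J' l (J' l - 1)
          omega
        · rw [Function.update_of_ne hli.symm, hJ'i]
  -- Downward induction on `J i`, with `s` bounding `k - J i`. At `s = 0` no monomial of degree `k`
  -- has a larger `i`-th exponent.
  have key : ∀ (s : ℕ) (J : Fin n → ℕ), ∑ l, J l = k → k ≤ J i + s →
      monomial (fun i => (m i : ℂ)) J ∈ R := by
    intro s
    induction s with
    | zero =>
      refine fun J hJ hs => step J hJ fun J' hJ' hi' => ?_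
      have := Finset.single_le_sum (f := J') (fun _ _ => Nat.zero_le _) (Finset.mem_univ i)
      omega
    | succ s ih =>
      exact fun J hJ hs => step J hJ fun J' hJ' hi' => ih J' hJ' (by omega)
  rintro _ ⟨J, hJ, rfl⟩
  rw [monomialBasis_apply]
  exact key k J hJ (Nat.le_add_left _ _)

/-! ### Dimension count -/

/-- Pascal's rule. It fails at `n = k = 0`, where it would read `0 = 0 + 1`. -/
theorem multichoose_eq_choose_add (n k : ℕ) (h : n + k ≠ 0) :
    n.multichoose (k + 1) = (n + (k + 1) - 2).choose (k + 1) + n.multichoose k := by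
  rcases n with _ | n
  · rcases k with _ | k
    · exact absurd rfl h
    · rw [Nat.multichoose_zero_succ, Nat.multichoose_zero_succ,
        Nat.choose_eq_zero_of_lt (by omega)]
  · rw [Nat.multichoose_succ_succ, Nat.multichoose_eq n]
    congr 2
    omega

end SlTwoVerma

theorem theorem5p1 (n k : ℕ) (m : Fin n → ℕ)
    (hm : (∃ i, k ≤ m i) ∨ (∑ i, (m i : ℤ)) - k + 1 < 0 ∨ (k : ℤ) ≤ (∑ i, (m i : ℤ)) - k + 1) :
    LinearMap.ker (SlTwoVerma.contraF (fun i => (m i : ℂ)) ((∑ i, (m i : ℂ)) - 2 * k)) = ⊥ ∧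
      Module.Finite ℂ
        (Module.Dual ℂ (SlTwoVerma.weightSpace (fun i => (m i : ℂ)) ((∑ i, (m i : ℂ)) - 2 * k)) ⧸
          LinearMap.range
            (SlTwoVerma.contraF (fun i => (m i : ℂ)) ((∑ i, (m i : ℂ)) - 2 * k))) ∧
      Module.finrank ℂ
        (Module.Dual ℂ (SlTwoVerma.weightSpace (fun i => (m i : ℂ)) ((∑ i, (m i : ℂ)) - 2 * k)) ⧸
          LinearMap.range
            (SlTwoVerma.contraF (fun i => (m i : ℂ)) ((∑ i, (m i : ℂ)) - 2 * k))) =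
        (n + k - 2).choose k := by
  have hsurj : weightSpace (fun i => (m i : ℂ)) ((∑ i, (m i : ℂ)) - 2 * k + 2) ≤
      (weightSpace (fun i => (m i : ℂ)) ((∑ i, (m i : ℂ)) - 2 * k)).map
        (tensorE fun i => (m i : ℂ)) := by
    rcases hm with ⟨i, hi⟩ | h
    · exact tensorE_surjective_of_le m k i hi
    · refine tensorE_surjective_of_ne _ k fun d hd => ?_
      have : ((∑ i, (m i : ℤ)) - k - d + 1 : ℤ) ≠ 0 := by omega
      exact_mod_cast (Int.cast_ne_zero (α := ℂ)).2 this
  have hinj : Function.Injective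
      (contraF (fun i => (m i : ℂ)) ((∑ i, (m i : ℂ)) - 2 * k)) := by
    refine LinearMap.dualMap_injective_of_surjective fun y => ?_
    obtain ⟨x, hx, hxy⟩ := hsurj y.2
    exact ⟨⟨x, hx⟩, Subtype.ext hxy⟩
  have := finite_weightSpace (fun i => (m i : ℂ)) k
  refine ⟨LinearMap.ker_eq_bot.2 hinj, inferInstance, ?_⟩
  have hq := Submodule.finrank_quotient_add_finrank
    (LinearMap.range (contraF (fun i => (m i : ℂ)) ((∑ i, (m i : ℂ)) - 2 * k)))
  rw [LinearMap.finrank_range_of_inj hinj, Subspace.dual_finrank_eq, Subspace.dual_finrank_eq,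
    finrank_weightSpace] at hq
  rcases k with _ | k
  · rw [Nat.multichoose_zero_right] at hq
    have h0 : finrank ℂ (weightSpace (fun i => (m i : ℂ))
        ((∑ i, (m i : ℂ)) - 2 * (0 : ℕ) + 2)) = 0 := by
      rw [Nat.cast_zero, mul_zero, sub_zero, weightSpace_above_top, finrank_bot]
    rw [h0, add_zero] at hq
    rw [hq, Nat.choose_zero_right]
  · have h1 : finrank ℂ (weightSpace (fun i => (m i : ℂ))
        ((∑ i, (m i : ℂ)) - 2 * (k + 1 : ℕ) + 2)) = n.multichoose k := by
      rw [show (∑ i, (m i : ℂ)) - 2 * ((k + 1 : ℕ) : ℂ) + 2 = (∑ i, (m i : ℂ)) - 2 * k by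
        push_cast; ring]
      exact finrank_weightSpace (fun i => (m i : ℂ)) k
    -- The exceptional case, an empty tensor product in degree one, violates all three hypotheses.
    -- It is also the only case with positive degree in which `n + k - 2` is truncated.
    have hnk : n + k ≠ 0 := by
      intro h
      obtain ⟨rfl, rfl⟩ : n = 0 ∧ k = 0 := by omega
      rcases hm with ⟨i, -⟩ | h | h
      · exact i.elim0
      · simp at h
      · simp at h
    rw [h1, multichoose_eq_choose_add n k hnk] at hq
    exact Nat.add_right_cancel hq
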